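/- Let $X$ be a Polish topological abelian group, with Borel $\sigma$-algebra $\mathcal B(X)$ (for example a Polish linear space such as $\mathbb R^d$). Let $\mathfrak X=\bigsqcup_{n\in\{0,1,2,\dots,\infty\}}X^n$ carry the disjoint union topology and its Borel $\sigma$-algebra, and put $\mathcal Z=X\times\mathfrak X$. For $S=X$ or $S=\mathcal Z$ let $\Gamma_S^\sharp$ be the space of generalized configurations in $S$, i.e. of $\{0,1,2,\dots,\infty\}$-valued measures on $S$ concentrated on a countable set (equivalently, countable aggregates of points of $S$, where multiple and accumulation points are allowed), with the $\sigma$-algebra generated by the sets $\{\gamma:\gamma(B)=n\}$, $B\in\mathcal B(S)$, $n\in\{0,1,2,\dots\}$. Unions $\bigsqcup$ and the notation $x\in\gamma$ below count points with multiplicity. Let $\mathfrak p:\mathfrak X\to\Gamma_X^\sharp$, $\mathfrak p(y_1,y_2,\dots)=\bigsqcup_i\{y_i\}$. Let $\mu_{\rm c}$ be a probability measure on $\Gamma_X^\sharp$, let $\eta$ be a probability measure on $\mathfrak X$, and let $\mu_0=\eta\circ\mathfrak p^{-1}$. The cluster measure $\mu_{\rm cl}$ is the law on $\Gamma_X^\sharp$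 of $\bigsqcup_{x\in\gamma_{\rm c}}\gamma'_x$, where $\gamma_{\rm c}$ has law $\mu_{\rm c}$ and, given $\gamma_{\rm c}$, the clusters $\gamma'_x$ ($x\in\gamma_{\rm c}$) are independent, $\gamma'_x$ having the law $\mu_x(A)=\mu_0(A-x)$. The lifted measure $\hat\mu$ is the law on $\Gamma_{\mathcal Z}^\sharp$ of $\bigsqcup_{x\in\gamma_{\rm c}}\{(x,\bar y_x)\}$, where $\gamma_{\rm c}$ has law $\mu_{\rm c}$ and, given $\gamma_{\rm c}$, the vectors $\bar y_x$ ($x\in\gamma_{\rm c}$) are i.i.d. with law $\eta$. Let $\mathfrak q:\Gamma_{\mathcal Z}^\sharp\to\Gamma_X^\sharp$ be given by $$\mathfrak q(\hat\gamma)=\bigsqcup_{(x,\bar y)\in\hat\gamma}\mathfrak q(x,\bar y),\qquad \mathfrak q(x,\bar y)=\mathfrak p(\bar y+x)=\bigsqcup_{y_i\in\bar y}\{y_i+x\}.$$ Then $\hat\mu$ and $\mu_{\rm cl}$ are well-defined probability measures, the maps $\mathfrak p$ and $\mathfrak q$ are measurable, and the cluster measure is the push-forward of the lifted measure under $\mathfrak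 q$: $$\mu_{\rm cl}=\mathfrak q^{*}\hat\mu\equiv\hat\mu\circ\mathfrak q^{-1}.$$ -/

import Mathlib

open MeasureTheory Set
open scoped ENNReal

noncomputable section

namespace Cluster

/-- The space `𝔛 = ⨆ₙ Xⁿ` (disjoint union over `n ∈ {0, 1, 2, …, ∞}`) of finite and infinite
sequences in `X`; an element of `Xⁿ` is a family indexed by the natural numbers `i < n`.
It carries the disjoint union topology and σ-algebra. -/
abbrev Vec (X : Type*) : Type _ := Σ n : ℕ∞, ({i : ℕ // (i : ℕ∞) < n} → X)

instance instMeasurableSingletonClassVec {X : Type*} [MeasurableSpace X]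
    [MeasurableSingletonClass X] : MeasurableSingletonClass (Vec X) := by
  refine ⟨fun v => ?_⟩
  obtain ⟨n, y⟩ := v
  refine MeasurableSpace.measurableSet_iInf.2 fun m => ?_
  change MeasurableSet (Sigma.mk m ⁻¹' {(⟨n, y⟩ : Vec X)})
  by_cases h : m = n
  · subst h
    have : Sigma.mk m ⁻¹' {(⟨m, y⟩ : Vec X)} = {y} := by
      ext z
      simp
    rw [this]
    exact measurableSet_singleton y
  · have : Sigma.mk m ⁻¹' {(⟨n, y⟩ : Vec X)} = ∅ := by
      ext z
      simp [h]
    rw [this]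
    exact MeasurableSet.empty

/-- The disjoint union σ-algebra on `𝔛` is the Borel σ-algebra of the disjoint union topology. -/
instance instBorelSpaceVec {X : Type*} [TopologicalSpace X] [SecondCountableTopology X]
    [MeasurableSpace X] [BorelSpace X] : BorelSpace (Vec X) := by
  refine ⟨le_antisymm ?_ ?_⟩
  · intro s hs
    have hs' : ∀ n, MeasurableSet (Sigma.mk n ⁻¹' s) := MeasurableSpace.measurableSet_iInf.1 hs
    have hU : s = ⋃ n, Sigma.mk n '' (Sigma.mk n ⁻¹' s) := by
      ext ⟨n, y⟩
      simp only [mem_iUnion]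
      constructor
      · intro h
        exact ⟨n, y, h, rfl⟩
      · rintro ⟨m, z, hz, h⟩
        rw [← h]
        exact hz
    rw [hU]
    let _ : MeasurableSpace (Vec X) := borel _
    have : BorelSpace (Vec X) := ⟨rfl⟩
    exact MeasurableSet.iUnion fun n =>
      (Topology.IsOpenEmbedding.sigmaMk (σ := fun n : ℕ∞ => {i : ℕ // (i : ℕ∞) < n} → X)
        (i := n)).measurableEmbedding.measurableSet_image.2 (hs' n)
  · refine MeasurableSpace.generateFrom_le fun s hs => ?_
    exact MeasurableSpace.measurableSet_iInf.2 fun n =>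
      (hs.preimage continuous_sigmaMk).measurableSet

/-- Generalized configurations in `X` (the space `Γ_X^♯`): measures on `X` with values in
`{0, 1, 2, …, ∞}` that are concentrated on a countable set. Multiple and accumulation points
are allowed. -/
@[ext]
structure Config (X : Type*) [MeasurableSpace X] where
  /-- The counting measure `B ↦ γ(B)` of the configuration. -/
  toMeasure : Measure X
  enat_valued : ∀ B, MeasurableSet B → ∃ n : ℕ∞, toMeasure B = (n : ℝ≥0∞)
  exists_countable : ∃ S : Set X, S.Countable ∧ toMeasure Sᶜ = 0

/-- The cylinder σ-algebra on `Γ_X^♯`, generated by the sets `{γ | γ(B) = n}`. -/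
instance instMeasurableSpaceConfig {X : Type*} [MeasurableSpace X] : MeasurableSpace (Config X) :=
  MeasurableSpace.generateFrom
    {C | ∃ (B : Set X) (n : ℕ), MeasurableSet B ∧ C = {γ : Config X | γ.toMeasure B = (n : ℝ≥0∞)}}

section Operations

variable {X Y : Type*} [MeasurableSpace X] [MeasurableSpace Y]

/-- The one-point configuration `{x}`. -/
def Config.single [MeasurableSingletonClass X] (x : X) : Config X :=
  ⟨Measure.dirac x, by
    intro B hB
    by_cases hx : x ∈ B
    · exact ⟨1, by simp [Measure.dirac_apply' x hB, hx]⟩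
    · exact ⟨0, by simp [Measure.dirac_apply' x hB, hx]⟩, by
    exact ⟨{x}, countable_singleton x, by simp⟩⟩

/-- The disjoint union (with multiplicities) `⨆ᵢ γᵢ` of countably many configurations, that is,
the sum of the corresponding measures. -/
def Config.union {ι : Type*} [Countable ι] (c : ι → Config X) : Config X :=
  ⟨Measure.sum fun i => (c i).toMeasure, by
    intro B hB
    choose n hn using fun i => (c i).enat_valued B hB
    rw [Measure.sum_apply _ hB]
    simp_rw [hn]
    have hmem : (∑' i, (n i : ℝ≥0∞)) ∈ range ENat.toENNReal := by
      refine ENat.isClosedEmbedding_toENNReal.isClosed_range.mem_of_tendsto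
        (ENNReal.summable (f := fun i => (n i : ℝ≥0∞))).hasSum (Filter.Eventually.of_forall ?_)
      intro s
      exact ⟨∑ i ∈ s, n i, map_sum ENat.toENNRealRingHom _ _⟩
    obtain ⟨m, hm⟩ := hmem
    exact ⟨m, hm.symm⟩, by
    choose S hS h0 using fun i => (c i).exists_countable
    refine ⟨⋃ i, S i, countable_iUnion hS, ?_⟩
    rw [Measure.sum_apply_eq_zero]
    intro i
    exact measure_mono_null (compl_subset_compl.2 (subset_iUnion S i)) (h0 i)⟩

/-- The points of a configuration `γ`, repeated according to their multiplicities: the point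
`x` is represented by the pairs `(x, k)` with `k < γ({x})`. -/
abbrev Config.Pt (γ : Config X) : Type _ :=
  {p : X × ℕ // (p.2 : ℝ≥0∞) < γ.toMeasure {p.1}}

/-- The location in `X` of a point of `γ`. -/
abbrev Config.Pt.loc {γ : Config X} (p : γ.Pt) : X := p.1.1

instance instCountablePt (γ : Config X) : Countable γ.Pt := by
  obtain ⟨S, hS, h0⟩ := γ.exists_countable
  refine Set.Countable.to_subtype (s := {p : X × ℕ | (p.2 : ℝ≥0∞) < γ.toMeasure {p.1}})
    ((hS.prod countable_univ).mono ?_)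
  rintro ⟨x, k⟩ hp
  refine ⟨by_contra fun hx => ?_, mem_univ _⟩
  have hz : γ.toMeasure {x} = 0 := measure_mono_null (singleton_subset_iff.2 hx) h0
  rw [mem_ofPred_eq, hz] at hp
  exact not_lt_zero hp

/-- Pointwise lifting of a map `f : X → Γ_Y^♯` to configurations: `γ ↦ ⨆_{x ∈ γ} f(x)`, where
the points of `γ` are taken with their multiplicities. -/
def Config.lift (f : X → Config Y) (γ : Config X) : Config Y :=
  Config.union fun p : γ.Pt => f p.loc

/-- The unpacking map `𝔭 : 𝔛 → Γ_X^♯`, `𝔭(x₁, x₂, …) = ⨆ᵢ {xᵢ}`. -/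
def unpack [MeasurableSingletonClass X] (v : Vec X) : Config X :=
  Config.union fun i => Config.single (v.2 i)

/-- Attaching marks to the points of `γ`: `γ ↦ ⨆_{x ∈ γ} {(x, ȳ_x)}`. -/
def attach [MeasurableSingletonClass X] [MeasurableSingletonClass Y] (γ : Config X)
    (y : γ.Pt → Y) : Config (X × Y) :=
  Config.union fun p => Config.single (p.loc, y p)

end Operations

section Lifted

variable {X : Type*} [MeasurableSpace X] [MeasurableSingletonClass X]

/-- The conditional law of `γ̂ = ⨆_{x ∈ γ} {(x, ȳ_x)}` given the centres `γ`: the vectors `ȳ_x`,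
`x ∈ γ`, are independent with common distribution `η`. -/
def liftedLaw (η : Measure (Vec X)) (γ : Config X) : Measure (Config (X × Vec X)) :=
  (Measure.infinitePi fun _ : γ.Pt => η).map (attach γ)

/-- The lifted measure `μ̂` on `Γ_𝒵^♯`, `𝒵 = X × 𝔛`, that is, `μ̂(A) = ∫ liftedLaw η γ A dμ_c(γ)`. -/
def liftedMeasure (μc : Measure (Config X)) (η : Measure (Vec X)) :
    Measure (Config (X × Vec X)) :=
  μc.bind (liftedLaw η)

end Lifted

section Shift

variable {X : Type*} [Add X]

/-- The shift `ȳ + x = (y₁ + x, y₂ + x, …)`. -/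
def Vec.shift (v : Vec X) (x : X) : Vec X := ⟨v.1, fun i => v.2 i + x⟩

variable [MeasurableSpace X] [MeasurableSingletonClass X]

/-- The translate `γ + x` of a configuration. -/
def Config.translate (x : X) (γ : Config X) : Config X :=
  Config.lift (fun y => Config.single (y + x)) γ

/-- The conditional law of a cluster configuration `⨆_{x ∈ γ} γ'_x` given the centres `γ`: the
clusters `γ'_x`, `x ∈ γ`, are independent and `γ'_x` has the law `μ_x(A) = μ₀(A - x)`. -/
def clusterLaw (μ₀ : Measure (Config X)) (γ : Config X) : Measure (Config X) :=
  (Measure.infinitePi fun p : γ.Pt => μ₀.map (Config.translate p.loc)).map Config.union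

/-- The law `μ_cl` of the i.i.d. cluster point process with law of centres `μ_c` and law `μ₀` of
the cluster centred at `0`, that is, `μ_cl(A) = ∫ clusterLaw μ₀ γ A dμ_c(γ)`. -/
def clusterMeasure (μc μ₀ : Measure (Config X)) : Measure (Config X) :=
  μc.bind (clusterLaw μ₀)

/-- The map `𝔮 : 𝒵 → Γ_X^♯`, `𝔮(x, ȳ) = 𝔭(ȳ + x) = ⨆ᵢ {yᵢ + x}`. -/
def qPoint (z : X × Vec X) : Config X := unpack (Vec.shift z.2 z.1)

/-- The map `𝔮 : Γ_𝒵^♯ → Γ_X^♯`, `𝔮(γ̂) = ⨆_{z ∈ γ̂} 𝔮(z)`. -/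
def qMap : Config (X × Vec X) → Config X := Config.lift qPoint

end Shift

end Cluster

end

/-!
Given the centres `γ`, both laws are images of the same product measure: by `𝔭(ȳ) + x = 𝔮(x, ȳ)`,
the union of the clusters `𝔭(ȳ_x) + x` is the image under `𝔮` of the configuration of the marked
points `(x, ȳ_x)`. Integrating over the centres gives the theorem once the law of the marked
configuration is known to depend measurably on `γ`, so that the mixture `μ̂` makes sense.

That dependence is read off from Laplace functionals. If the marks are independent with law `η`,
then `exp (-∫ f)` has expectation `exp (-∫ g dγ)`, where `g x = -log ∫ exp (-f (x, y)) dη(y)`, and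
this is measurable in `γ`. The functionals `exp (-∫ f)` are bounded, closed under products, and
their level sets generate the cylinder σ-algebra, so a multiplicative class argument applies.
-/

namespace Cluster

open Filter Topology

section MultiplicativeClass

theorem isPiSystem_zeroSets {Ω : Type*} (𝒜 : Subalgebra ℝ (Ω → ℝ)) :
    IsPiSystem ((fun g : Ω → ℝ => g ⁻¹' {0}) '' 𝒜) := by
  rintro _ ⟨g, hg, rfl⟩ _ ⟨h, hh, rfl⟩ -
  refine ⟨g ^ 2 + h ^ 2, 𝒜.add_mem (𝒜.pow_mem hg 2) (𝒜.pow_mem hh 2), ?_⟩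
  ext ω
  simp [add_eq_zero_iff_of_nonneg (sq_nonneg (g ω)) (sq_nonneg (h ω))]

variable {Ω α : Type*} [MeasurableSpace Ω] [MeasurableSpace α]

/-- The algebra of bounded measurable real functions, as an algebra of honest functions (not of
classes modulo null sets), so that it can be used for all members of a family of measures. -/
def boundedMeasurable (Ω : Type*) [MeasurableSpace Ω] : Subalgebra ℝ (Ω → ℝ) where
  carrier := {h | Measurable h ∧ ∃ C, ∀ ω, |h ω| ≤ C}
  mul_mem' := by
    rintro g h ⟨hg, C, hC⟩ ⟨hh, D, hD⟩
    refine ⟨hg.mul hh, C * D, fun ω => ?_⟩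
    rw [Pi.mul_apply, abs_mul]
    exact mul_le_mul (hC ω) (hD ω) (abs_nonneg _) ((abs_nonneg _).trans (hC ω))
  add_mem' := by
    rintro g h ⟨hg, C, hC⟩ ⟨hh, D, hD⟩
    exact ⟨hg.add hh, C + D, fun ω => (abs_add_le _ _).trans (add_le_add (hC ω) (hD ω))⟩
  algebraMap_mem' r := ⟨measurable_const, |r|, fun _ => le_rfl⟩

theorem integrable_of_mem_boundedMeasurable {h : Ω → ℝ} (hh : h ∈ boundedMeasurable Ω)
    (μ : Measure Ω) [IsFiniteMeasure μ] : Integrable h μ := by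
  obtain ⟨hm, C, hC⟩ := hh
  exact .of_bound hm.aestronglyMeasurable C (ae_of_all _ hC)

theorem tendsto_integral_pow {μ : Measure Ω} [IsFiniteMeasure μ] {h : Ω → ℝ} (hm : Measurable h)
    (h01 : ∀ ω, h ω ∈ Icc 0 1) :
    Tendsto (fun k : ℕ => ∫ ω, h ω ^ k ∂μ) atTop (𝓝 (μ.real (h ⁻¹' {1}))) := by
  rw [← integral_indicator_one (hm (measurableSet_singleton 1))]
  refine tendsto_integral_of_dominated_convergence (fun _ => 1)
    (fun k => (hm.pow_const k).aestronglyMeasurable) (integrable_const 1)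
    (fun k => ae_of_all _ fun ω => ?_) (ae_of_all _ fun ω => ?_)
  · rw [Real.norm_of_nonneg (pow_nonneg (h01 ω).1 k)]
    exact pow_le_one₀ (h01 ω).1 (h01 ω).2
  · rcases (h01 ω).2.eq_or_lt with hω | hω
    · simp [hω]
    · simpa [indicator, hω.ne] using tendsto_pow_atTop_nhds_zero_of_lt_one (h01 ω).1 hω

variable {κ : α → Measure Ω} [∀ a, IsFiniteMeasure (κ a)]

theorem measurable_measure_zeroSet {𝒜 : Subalgebra ℝ (Ω → ℝ)} (h𝒜 : 𝒜 ≤ boundedMeasurable Ω)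
    (h_int : ∀ h ∈ 𝒜, Measurable fun a => ∫ ω, h ω ∂κ a) {g : Ω → ℝ} (hg : g ∈ 𝒜) :
    Measurable fun a => κ a (g ⁻¹' {0}) := by
  obtain ⟨-, C, hC⟩ := h𝒜 hg
  -- With `D > |g|`, the powers `(1 - (g / D) ^ 2) ^ k` decrease to the indicator of `g = 0`.
  let D := |C| + 1
  have hD : 0 < D := by positivity
  let h : Ω → ℝ := 1 - (D⁻¹ • g) ^ 2
  have hh : h ∈ 𝒜 := 𝒜.sub_mem 𝒜.one_mem (𝒜.pow_mem (𝒜.smul_mem hg _) 2)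
  have h01 : ∀ ω, h ω ∈ Icc 0 1 := fun ω => by
    have hle : |D⁻¹ * g ω| ≤ 1 := by
      rw [abs_mul, abs_inv, abs_of_pos hD, inv_mul_le_one₀ hD]
      linarith [hC ω, le_abs_self C]
    exact ⟨sub_nonneg.2 ((sq_le_one_iff_abs_le_one _).2 hle), sub_le_self _ (sq_nonneg _)⟩
  have h_zero : g ⁻¹' {0} = h ⁻¹' {1} := by
    ext ω
    simp [h, hD.ne']
  have h_real : Measurable fun a => (κ a).real (h ⁻¹' {1}) :=
    measurable_of_tendsto_metrizable (fun k => h_int _ (𝒜.pow_mem hh k))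
      (tendsto_pi_nhds.2 fun a => tendsto_integral_pow (h𝒜 hh).1 h01)
  simpa [h_zero] using h_real.ennreal_ofReal

theorem measurable_integral_of_mem_adjoin {M : Submonoid (Ω → ℝ)}
    (hM : (M : Set (Ω → ℝ)) ⊆ boundedMeasurable Ω)
    (h_int : ∀ h ∈ M, Measurable fun a => ∫ ω, h ω ∂κ a) {g : Ω → ℝ}
    (hg : g ∈ Algebra.adjoin ℝ (M : Set (Ω → ℝ))) : Measurable fun a => ∫ ω, g ω ∂κ a := by
  have h_span : Submodule.span ℝ (M : Set (Ω → ℝ)) ≤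
      Subalgebra.toSubmodule (boundedMeasurable Ω) := Submodule.span_le.2 hM
  rw [← Subalgebra.mem_toSubmodule, Algebra.adjoin_eq_span, Submonoid.closure_eq] at hg
  induction hg using Submodule.span_induction with
  | mem h hh => exact h_int h hh
  | zero => simp
  | add g h hg hh ihg ihh =>
    simp_rw [Pi.add_apply, fun a => integral_add
      (integrable_of_mem_boundedMeasurable (h_span hg) (κ a))
      (integrable_of_mem_boundedMeasurable (h_span hh) (κ a))]
    exact ihg.add ihh
  | smul c h _ ih =>
    simp_rw [Pi.smul_apply, integral_smul]
    exact ih.const_smul c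

theorem measurable_of_measurable_integral_of_submonoid {M : Submonoid (Ω → ℝ)}
    (hM : (M : Set (Ω → ℝ)) ⊆ boundedMeasurable Ω)
    (h_int : ∀ h ∈ M, Measurable fun a => ∫ ω, h ω ∂κ a)
    (h_gen : ‹MeasurableSpace Ω› ≤
      MeasurableSpace.generateFrom {s | ∃ h ∈ M, ∃ c : ℝ, s = h ⁻¹' {c}}) :
    Measurable κ := by
  let 𝒜 := Algebra.adjoin ℝ (M : Set (Ω → ℝ))
  have h𝒜 : 𝒜 ≤ boundedMeasurable Ω := Algebra.adjoin_le hM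
  have h_zero : ∀ g ∈ 𝒜, Measurable fun a => κ a (g ⁻¹' {0}) := fun g hg =>
    measurable_measure_zeroSet h𝒜 (fun h hh => measurable_integral_of_mem_adjoin hM h_int hh) hg
  refine .measure_of_isPiSystem (le_antisymm (h_gen.trans ?_) ?_) (isPiSystem_zeroSets 𝒜) ?_ ?_
  · refine MeasurableSpace.generateFrom_mono ?_
    rintro _ ⟨h, hh, c, rfl⟩
    refine ⟨h - algebraMap ℝ _ c,
      𝒜.sub_mem (Algebra.subset_adjoin hh) (𝒜.algebraMap_mem c), ?_⟩
    ext ω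
    simp [sub_eq_zero]
  · refine MeasurableSpace.generateFrom_le ?_
    rintro _ ⟨g, hg, rfl⟩
    exact (h𝒜 hg).1 (measurableSet_singleton 0)
  · rintro _ ⟨g, hg, rfl⟩
    exact h_zero g hg
  · simpa [preimage_const_of_mem] using h_zero (fun _ => 0) 𝒜.zero_mem

end MultiplicativeClass

section ExpNeg

/-- `x ↦ e^{-x}` on `[0, ∞]`, with `e^{-∞} = 0`. -/
noncomputable def expNeg (x : ℝ≥0∞) : ℝ≥0∞ := EReal.exp (-(x : EReal))

/-- `t ↦ -log t` on `[0, 1]`, with `-log 0 = ∞`; truncated to `0` for `t > 1`. -/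
noncomputable def negLog (t : ℝ≥0∞) : ℝ≥0∞ := (-ENNReal.log t).toENNReal

theorem continuous_expNeg : Continuous expNeg :=
  ENNReal.continuous_exp.comp (continuous_neg.comp continuous_coe_ennreal_ereal)

theorem measurable_negLog : Measurable negLog :=
  measurable_ereal_toENNReal.comp (continuous_neg.measurable.comp ENNReal.measurable_log)

theorem expNeg_le_one (x : ℝ≥0∞) : expNeg x ≤ 1 := by
  simp [expNeg, EReal.coe_ennreal_nonneg]

theorem expNeg_ne_top (x : ℝ≥0∞) : expNeg x ≠ ∞ :=
  ((expNeg_le_one x).trans_lt ENNReal.one_lt_top).ne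

theorem expNeg_injective : Function.Injective expNeg := fun x y h => by
  simpa using EReal.exp_strictMono.injective h

@[simp]
theorem expNeg_zero : expNeg 0 = 1 := by
  simp [expNeg]

theorem expNeg_add (x y : ℝ≥0∞) : expNeg (x + y) = expNeg x * expNeg y := by
  rw [expNeg, expNeg, expNeg, ← EReal.exp_add, EReal.coe_ennreal_add, EReal.neg_add, sub_eq_add_neg]
  · exact Or.inl (EReal.coe_ennreal_ne_bot x)
  · exact Or.inr (EReal.coe_ennreal_ne_bot y)

theorem expNeg_finset_sum {ι : Type*} (s : Finset ι) (x : ι → ℝ≥0∞) :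
    expNeg (∑ i ∈ s, x i) = ∏ i ∈ s, expNeg (x i) := by
  classical
  induction s using Finset.induction_on with
  | empty => simp
  | insert i s hi ih => rw [Finset.sum_insert hi, Finset.prod_insert hi, expNeg_add, ih]

theorem hasProd_expNeg {ι : Type*} (x : ι → ℝ≥0∞) :
    HasProd (fun i => expNeg (x i)) (expNeg (∑' i, x i)) := by
  simp_rw [HasProd, SummationFilter.unconditional_filter, ← expNeg_finset_sum]
  exact (continuous_expNeg.tendsto _).comp ENNReal.summable.hasSum

theorem expNeg_negLog {t : ℝ≥0∞} (ht : t ≤ 1) : expNeg (negLog t) = t := by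
  rw [expNeg, negLog, EReal.coe_toENNReal, neg_neg, ENNReal.exp_log]
  simpa [EReal.le_neg] using ht

section Independent

variable {ι : Type*} {Y : ι → Type*} [∀ i, MeasurableSpace (Y i)]
  (ν : ∀ i, Measure (Y i)) [∀ i, IsProbabilityMeasure (ν i)] {f : ∀ i, Y i → ℝ≥0∞}

theorem lintegral_prod_infinitePi (hf : ∀ i, Measurable (f i)) (s : Finset ι) :
    ∫⁻ y, ∏ i ∈ s, f i (y i) ∂Measure.infinitePi ν = ∏ i ∈ s, ∫⁻ y, f i y ∂ν i := by
  rw [ProbabilityTheory.lintegral_prod_eq_prod_lintegral_of_indepFun s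
    (fun i (y : ∀ i, Y i) => f i (y i)) (ProbabilityTheory.iIndepFun_infinitePi hf)
    fun i => (hf i).comp (measurable_pi_apply i)]
  exact Finset.prod_congr rfl fun i _ =>
    (measurePreserving_eval_infinitePi ν i).lintegral_comp (hf i)

theorem lintegral_expNeg_tsum_infinitePi [Countable ι] (hf : ∀ i, Measurable (f i)) :
    ∫⁻ y, expNeg (∑' i, f i (y i)) ∂Measure.infinitePi ν =
      expNeg (∑' i, negLog (∫⁻ y, expNeg (f i y) ∂ν i)) := by
  have h_exp : ∀ i, Measurable fun y => expNeg (f i y) :=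
    fun i => continuous_expNeg.measurable.comp (hf i)
  have h_le : ∀ i, ∫⁻ y, expNeg (f i y) ∂ν i ≤ 1 := fun i =>
    (lintegral_mono fun y => expNeg_le_one _).trans (by simp)
  have h_fin : ∀ s : Finset ι, ∫⁻ y, ∏ i ∈ s, expNeg (f i (y i)) ∂Measure.infinitePi ν =
      ∏ i ∈ s, expNeg (negLog (∫⁻ y, expNeg (f i y) ∂ν i)) := fun s => by
    simp_rw [lintegral_prod_infinitePi ν h_exp, fun i => expNeg_negLog (h_le i)]
  have h_lim : Tendsto
      (fun s : Finset ι => ∫⁻ y, ∏ i ∈ s, expNeg (f i (y i)) ∂Measure.infinitePi ν)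
      atTop (𝓝 (∫⁻ y, expNeg (∑' i, f i (y i)) ∂Measure.infinitePi ν)) := by
    refine tendsto_lintegral_filter_of_dominated_convergence (fun _ => 1)
      (.of_forall fun s => ?_) (.of_forall fun s => ae_of_all _ fun y => ?_)
      (by simp) (ae_of_all _ fun y => hasProd_expNeg _)
    · exact Finset.measurable_prod _ fun i _ => (h_exp i).comp (measurable_pi_apply i)
    · exact Finset.prod_le_one' fun i _ => expNeg_le_one _
  simp_rw [h_fin] at h_lim
  exact tendsto_nhds_unique h_lim (hasProd_expNeg _)

end Independent

end ExpNeg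

theorem enatCard_subtype_natCast_lt (n : ℕ∞) :
    ENat.card {k : ℕ // (k : ℝ≥0∞) < (n : ℝ≥0∞)} = n := by
  induction n using ENat.recTopCoe with
  | top => simpa using (Equiv.subtypeUnivEquiv fun _ : ℕ => trivial).infinite_iff.2 inferInstance
  | coe n => simp [ENat.card_congr (Fin.equivSubtype (n := n)).symm]

theorem lintegral_eq_tsum_of_countable {X : Type*} [MeasurableSpace X] [MeasurableSingletonClass X]
    {μ : Measure X} {S : Set X} (hS : S.Countable) (h0 : μ Sᶜ = 0) (f : X → ℝ≥0∞) :
    ∫⁻ x, f x ∂μ = ∑' x, f x * μ {x} := by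
  rw [← setLIntegral_univ, ← setLIntegral_congr (s := S) (ae_eq_univ.2 h0),
    lintegral_countable f hS]
  refine tsum_subtype_eq_of_support_subset (f := fun x => f x * μ {x}) fun x hx =>
    by_contra fun hxS => hx ?_
  simp [measure_mono_null (singleton_subset_iff.2 hxS) h0]

namespace Config

variable {X Y α : Type*} [MeasurableSpace X] [MeasurableSpace Y] [MeasurableSpace α]

theorem ext_of_apply {γ γ' : Config X}
    (h : ∀ B, MeasurableSet B → γ.toMeasure B = γ'.toMeasure B) : γ = γ' :=
  Config.ext (Measure.ext h)

theorem measurable_apply {B : Set X} (hB : MeasurableSet B) :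
    Measurable fun γ : Config X => γ.toMeasure B := by
  choose n hn using fun γ : Config X => γ.enat_valued B hB
  have h_nat : Measurable n := ENat.measurable_iff.2 fun k => by
    refine MeasurableSpace.measurableSet_generateFrom ⟨B, k, hB, ?_⟩
    ext γ
    simp [hn, ← ENat.toENNReal_coe]
  simp_rw [hn]
  exact (measurable_of_countable ENat.toENNReal).comp h_nat

theorem measurable_of_apply {f : α → Config X}
    (h : ∀ B, MeasurableSet B → Measurable fun a => (f a).toMeasure B) : Measurable f := by
  refine measurable_generateFrom ?_
  rintro _ ⟨B, n, hB, rfl⟩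
  exact h B hB (measurableSet_singleton _)

theorem measurable_toMeasure : Measurable (toMeasure (X := X)) :=
  Measure.measurable_of_measurable_coe _ fun _ hB => measurable_apply hB

theorem union_apply {ι : Type*} [Countable ι] (c : ι → Config X) {B : Set X}
    (hB : MeasurableSet B) : (union c).toMeasure B = ∑' i, (c i).toMeasure B :=
  Measure.sum_apply _ hB

theorem measurable_union {ι : Type*} [Countable ι] :
    Measurable (union : (ι → Config X) → Config X) := by
  refine measurable_of_apply fun B hB => ?_
  simp_rw [union_apply _ hB]
  exact .tsum fun i => (measurable_apply hB).comp (measurable_pi_apply i)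

variable [MeasurableSingletonClass X]

theorem measurable_single : Measurable (single : X → Config X) :=
  measurable_of_apply fun _ hB => (Measure.measurable_coe hB).comp Measure.measurable_dirac

theorem measurable_union_single {ι : Type*} [Countable ι] :
    Measurable fun x : ι → X => union fun i => single (x i) :=
  measurable_union.comp <| measurable_pi_lambda _ fun i =>
    measurable_single.comp (measurable_pi_apply i)

theorem lintegral_union_single {ι : Type*} [Countable ι] (x : ι → X) (f : X → ℝ≥0∞) :
    ∫⁻ z, f z ∂(union fun i => single (x i)).toMeasure = ∑' i, f (x i) := by
  simp_rw [union, single, lintegral_sum_measure, lintegral_dirac]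

theorem lintegral_toMeasure (γ : Config X) (f : X → ℝ≥0∞) :
    ∫⁻ x, f x ∂γ.toMeasure = ∑' p : γ.Pt, f p.loc := by
  obtain ⟨S, hS, h0⟩ := γ.exists_countable
  have h_card : ∀ x, (ENat.card {k : ℕ // (k : ℝ≥0∞) < γ.toMeasure {x}} : ℝ≥0∞) =
      γ.toMeasure {x} := fun x => by
    obtain ⟨n, hn⟩ := γ.enat_valued {x} (measurableSet_singleton x)
    rw [hn, enatCard_subtype_natCast_lt]
  calc ∫⁻ x, f x ∂γ.toMeasure
    _ = ∑' x, γ.toMeasure {x} * f x := by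
      simp_rw [lintegral_eq_tsum_of_countable hS h0, mul_comm]
    _ = ∑' x, ∑' _ : {k : ℕ // (k : ℝ≥0∞) < γ.toMeasure {x}}, f x := by
      simp_rw [ENNReal.tsum_const, h_card]
    _ = ∑' q : Σ x, {k : ℕ // (k : ℝ≥0∞) < γ.toMeasure {x}}, f q.1 :=
      (ENNReal.tsum_sigma' fun q : Σ x, {k : ℕ // (k : ℝ≥0∞) < γ.toMeasure {x}} => f q.1).symm
    _ = ∑' p : γ.Pt, f p.loc :=
      ((Equiv.subtypeProdEquivSigmaSubtype fun x (k : ℕ) =>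
        (k : ℝ≥0∞) < γ.toMeasure {x}).tsum_eq fun q => f q.1).symm

theorem lift_apply (f : X → Config Y) (γ : Config X) {B : Set Y} (hB : MeasurableSet B) :
    (lift f γ).toMeasure B = ∫⁻ x, (f x).toMeasure B ∂γ.toMeasure := by
  rw [lintegral_toMeasure, lift, union_apply _ hB]

theorem measurable_lift {f : X → Config Y} (hf : Measurable f) : Measurable (lift f) := by
  refine measurable_of_apply fun B hB => ?_
  simp_rw [lift_apply f _ hB]
  exact (Measure.measurable_lintegral ((measurable_apply hB).comp hf)).comp measurable_toMeasure

theorem lift_union_single {ι : Type*} [Countable ι] (f : X → Config Y) (x : ι → X) :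
    lift f (union fun i => single (x i)) = union fun i => f (x i) :=
  ext_of_apply fun B hB => by rw [lift_apply f _ hB, lintegral_union_single, union_apply _ hB]

end Config

section Laplace

variable {X : Type*} [MeasurableSpace X]

/-- The Laplace functional `γ ↦ exp (-∫ f dγ)`; it characterizes laws of random configurations
because it is bounded and multiplicative in `f`. -/
noncomputable def Config.laplace (f : X → ℝ≥0∞) (γ : Config X) : ℝ≥0∞ :=
  expNeg (∫⁻ x, f x ∂γ.toMeasure)

theorem Config.measurable_laplace {f : X → ℝ≥0∞} (hf : Measurable f) :
    Measurable (Config.laplace f) :=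
  continuous_expNeg.measurable.comp
    ((Measure.measurable_lintegral hf).comp Config.measurable_toMeasure)

/-- The multiplicative class of the Laplace functionals of measurable functions, made real-valued
in order to span a real algebra. -/
def laplaceSubmonoid (X : Type*) [MeasurableSpace X] : Submonoid (Config X → ℝ) where
  carrier := {h | ∃ f : X → ℝ≥0∞, Measurable f ∧ h = fun γ => (γ.laplace f).toReal}
  one_mem' := ⟨0, measurable_const, by ext γ; simp [Config.laplace]⟩
  mul_mem' := by
    rintro _ _ ⟨f, hf, rfl⟩ ⟨g, hg, rfl⟩
    refine ⟨f + g, hf.add hg, ?_⟩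
    ext γ
    simp [Config.laplace, lintegral_add_left hf, expNeg_add]

theorem laplaceSubmonoid_subset_boundedMeasurable :
    (laplaceSubmonoid X : Set (Config X → ℝ)) ⊆ boundedMeasurable (Config X) := by
  rintro _ ⟨f, hf, rfl⟩
  refine ⟨(Config.measurable_laplace hf).ennreal_toReal, 1, fun γ => ?_⟩
  rw [ENNReal.abs_toReal]
  exact ENNReal.toReal_mono ENNReal.one_ne_top (expNeg_le_one _)

theorem le_generateFrom_level_laplaceSubmonoid :
    instMeasurableSpaceConfig (X := X) ≤
      MeasurableSpace.generateFrom {s | ∃ h ∈ laplaceSubmonoid X, ∃ c : ℝ, s = h ⁻¹' {c}} := by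
  refine MeasurableSpace.generateFrom_mono ?_
  rintro _ ⟨B, n, hB, rfl⟩
  refine ⟨_, ⟨indicator B 1, measurable_one.indicator hB, rfl⟩, (expNeg n).toReal, ?_⟩
  ext γ
  simp [Config.laplace, lintegral_indicator_one hB,
    ENNReal.toReal_eq_toReal_iff' (expNeg_ne_top _) (expNeg_ne_top _), expNeg_injective.eq_iff]

theorem measurable_of_measurable_lintegral_laplace {α : Type*} [MeasurableSpace α]
    {κ : α → Measure (Config X)} [∀ a, IsFiniteMeasure (κ a)]
    (h : ∀ f, Measurable f → Measurable fun a => ∫⁻ γ, γ.laplace f ∂κ a) : Measurable κ := by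
  refine measurable_of_measurable_integral_of_submonoid
    laplaceSubmonoid_subset_boundedMeasurable ?_ le_generateFrom_level_laplaceSubmonoid
  rintro _ ⟨f, hf, rfl⟩
  simp_rw [fun a => integral_toReal (Config.measurable_laplace hf).aemeasurable
    (ae_of_all (κ a) fun γ => (expNeg_ne_top (∫⁻ x, f x ∂γ.toMeasure)).lt_top)]
  exact (h f hf).ennreal_toReal

end Laplace

section Marking

variable {X Y Z : Type*} [MeasurableSpace X] [MeasurableSpace Y] [MeasurableSpace Z]
  [MeasurableSingletonClass X] [MeasurableSingletonClass Y]

theorem measurable_attach (γ : Config X) : Measurable (attach (Y := Y) γ) :=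
  Config.measurable_union_single.comp <| measurable_pi_lambda _ fun p =>
    measurable_const.prodMk (measurable_pi_apply p)

/-- The law of the configuration obtained from `γ` by attaching to its points independent marks
with law `η`; `liftedLaw` is the case where the marks are vectors. -/
noncomputable def markedLaw (η : Measure Y) (γ : Config X) : Measure (Config (X × Y)) :=
  (Measure.infinitePi fun _ : γ.Pt => η).map (attach γ)

variable (η : Measure Y) [IsProbabilityMeasure η]

instance isProbabilityMeasure_markedLaw (γ : Config X) : IsProbabilityMeasure (markedLaw η γ) :=
  Measure.isProbabilityMeasure_map (measurable_attach γ).aemeasurable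

theorem lintegral_laplace_markedLaw (γ : Config X) {f : X × Y → ℝ≥0∞} (hf : Measurable f) :
    ∫⁻ γ', γ'.laplace f ∂markedLaw η γ =
      γ.laplace fun x => negLog (∫⁻ y, expNeg (f (x, y)) ∂η) := by
  rw [markedLaw, lintegral_map (Config.measurable_laplace hf) (measurable_attach γ)]
  simp_rw [Config.laplace, attach, Config.lintegral_union_single, Config.lintegral_toMeasure]
  exact lintegral_expNeg_tsum_infinitePi (fun _ : γ.Pt => η)
    fun p => hf.comp measurable_prodMk_left

theorem measurable_markedLaw : Measurable (markedLaw (X := X) η) := by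
  refine measurable_of_measurable_lintegral_laplace fun f hf => ?_
  simp_rw [lintegral_laplace_markedLaw η _ hf]
  exact Config.measurable_laplace <| measurable_negLog.comp
    (continuous_expNeg.measurable.comp hf).lintegral_prod_right'

theorem map_lift_markedLaw {q : X × Y → Config Z} (hq : Measurable q) (γ : Config X) :
    (markedLaw η γ).map (Config.lift q) =
      (Measure.infinitePi fun p : γ.Pt => η.map fun y => q (p.loc, y)).map Config.union := by
  have hq_p : ∀ p : γ.Pt, Measurable fun y => q (p.loc, y) :=
    fun p => hq.comp measurable_prodMk_left
  have h_pi : Measurable fun (y : γ.Pt → Y) p => q (p.loc, y p) :=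
    measurable_pi_lambda _ fun p => (hq_p p).comp (measurable_pi_apply p)
  rw [markedLaw, Measure.map_map (Config.measurable_lift hq) (measurable_attach γ),
    ← Measure.infinitePi_map_pi (fun _ : γ.Pt => η) hq_p,
    Measure.map_map Config.measurable_union h_pi]
  simp_rw [Function.comp_def, attach, Config.lift_union_single]

end Marking

theorem map_bind_measure {α β δ : Type*} [MeasurableSpace α] [MeasurableSpace β]
    [MeasurableSpace δ] {μ : Measure α} {κ : α → Measure β} (hκ : Measurable κ) {f : β → δ}
    (hf : Measurable f) : (μ.bind κ).map f = μ.bind fun a => (κ a).map f := by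
  simp_rw [← Measure.bind_dirac_eq_map _ hf]
  exact Measure.bind_bind hκ.aemeasurable (Measure.measurable_dirac.comp hf).aemeasurable

theorem measurableEmbedding_sigmaMk {ι : Type*} {π : ι → Type*} [∀ i, MeasurableSpace (π i)]
    (i : ι) : MeasurableEmbedding (Sigma.mk i : π i → Σ i, π i) where
  injective := sigma_mk_injective
  measurable := fun _ hs => MeasurableSpace.measurableSet_iInf.1 hs i
  measurableSet_image' := fun s hs => MeasurableSpace.measurableSet_iInf.2 fun j => by
    change MeasurableSet (Sigma.mk j ⁻¹' (Sigma.mk i '' s))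
    by_cases h : j = i
    · subst h
      rwa [preimage_image_eq _ sigma_mk_injective]
    · rw [preimage_image_sigmaMk_of_ne h]
      exact .empty

theorem measurable_of_comp_prodMap_sigmaMk {ι : Type*} [Countable ι] {π : ι → Type*}
    [∀ i, MeasurableSpace (π i)] {Y Z : Type*} [MeasurableSpace Y] [MeasurableSpace Z]
    {F : Y × (Σ i, π i) → Z} (hF : ∀ i, Measurable (F ∘ Prod.map id (Sigma.mk i))) :
    Measurable F := by
  intro s hs
  have h_union : F ⁻¹' s =
      ⋃ i, Prod.map id (Sigma.mk i) '' ((F ∘ Prod.map id (Sigma.mk i)) ⁻¹' s) := by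
    ext ⟨y, i, v⟩
    simp only [mem_preimage, mem_iUnion, mem_image]
    constructor
    · exact fun h => ⟨i, (y, v), h, rfl⟩
    · rintro ⟨j, z, hz, h_eq⟩
      rwa [← h_eq]
  rw [h_union]
  exact .iUnion fun i =>
    (MeasurableEmbedding.id.prodMap (measurableEmbedding_sigmaMk i)).measurableSet_image.2 (hF i hs)

section Clusters

variable {X : Type*} [MeasurableSpace X] [MeasurableSingletonClass X]

theorem measurable_unpack : Measurable (unpack (X := X)) := fun _ hs =>
  MeasurableSpace.measurableSet_iInf.2 fun _ => Config.measurable_union_single hs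

theorem translate_unpack [Add X] (x : X) (v : Vec X) : (unpack v).translate x = qPoint (x, v) :=
  Config.lift_union_single _ v.2

theorem measurable_translate [Add X] [MeasurableAdd X] (x : X) :
    Measurable (Config.translate x) := by
  unfold Config.translate
  exact Config.measurable_lift (Config.measurable_single.comp (measurable_add_const x))

variable [Add X] [MeasurableAdd₂ X]

theorem measurable_qPoint : Measurable (qPoint (X := X)) := by
  refine measurable_of_comp_prodMap_sigmaMk fun n => ?_
  have h_shift : Measurable fun z : X × ({i : ℕ // (i : ℕ∞) < n} → X) => fun i => z.2 i + z.1 := by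
    fun_prop
  change Measurable fun z : X × ({i : ℕ // (i : ℕ∞) < n} → X) =>
    Config.union fun i => Config.single (z.2 i + z.1)
  exact Config.measurable_union_single.comp h_shift

theorem measurable_qMap : Measurable (qMap (X := X)) :=
  Config.measurable_lift measurable_qPoint

theorem map_translate_map_unpack (η : Measure (Vec X)) (x : X) :
    (η.map unpack).map (Config.translate x) = η.map fun v => qPoint (x, v) := by
  simp_rw [Measure.map_map (measurable_translate x) measurable_unpack, Function.comp_def,
    translate_unpack]

theorem clusterLaw_map_unpack (η : Measure (Vec X)) [IsProbabilityMeasure η] (γ : Config X) :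
    clusterLaw (η.map unpack) γ = (liftedLaw η γ).map qMap := by
  simp_rw [clusterLaw, map_translate_map_unpack]
  exact (map_lift_markedLaw η measurable_qPoint γ).symm

end Clusters

end Cluster

theorem mainTheorem4_general {X : Type*} [MeasurableSpace X] [MeasurableSingletonClass X]
    [Add X] [MeasurableAdd₂ X]
    (μc : Measure (Cluster.Config X)) [IsProbabilityMeasure μc]
    (μ₀ : Measure (Cluster.Config X))
    (η : Measure (Cluster.Vec X)) [IsProbabilityMeasure η] (hη : μ₀ = η.map Cluster.unpack) :
    IsProbabilityMeasure (Cluster.liftedMeasure μc η) ∧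
    IsProbabilityMeasure (Cluster.clusterMeasure μc μ₀) ∧
    Measurable (Cluster.unpack (X := X)) ∧ Measurable (Cluster.qMap (X := X)) ∧
    Cluster.clusterMeasure μc μ₀ = (Cluster.liftedMeasure μc η).map Cluster.qMap := by
  have h_law : Measurable (Cluster.liftedLaw (X := X) η) := Cluster.measurable_markedLaw η
  have h_q : Measurable (Cluster.qMap (X := X)) := Cluster.measurable_qMap
  have h_lift : IsProbabilityMeasure (Cluster.liftedMeasure μc η) :=
    isProbabilityMeasure_bind h_law.aemeasurable <|
      ae_of_all _ (Cluster.isProbabilityMeasure_markedLaw η)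
  have h_eq : Cluster.clusterMeasure μc μ₀ = (Cluster.liftedMeasure μc η).map Cluster.qMap := by
    rw [Cluster.liftedMeasure, Cluster.map_bind_measure h_law h_q, Cluster.clusterMeasure, hη]
    exact congrArg μc.bind (funext (Cluster.clusterLaw_map_unpack η))
  refine ⟨h_lift, ?_, Cluster.measurable_unpack, h_q, h_eq⟩
  rw [h_eq]
  exact Measure.isProbabilityMeasure_map h_q.aemeasurable

theorem mainTheorem4 {X : Type*} [AddCommGroup X] [TopologicalSpace X] [IsTopologicalAddGroup X]
    [PolishSpace X] [MeasurableSpace X] [BorelSpace X]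
    (μc : MeasureTheory.Measure (Cluster.Config X)) [MeasureTheory.IsProbabilityMeasure μc]
    (μ₀ : MeasureTheory.Measure (Cluster.Config X)) [MeasureTheory.IsProbabilityMeasure μ₀]
    (η : MeasureTheory.Measure (Cluster.Vec X)) [MeasureTheory.IsProbabilityMeasure η]
    (hη : μ₀ = η.map Cluster.unpack) :
    MeasureTheory.IsProbabilityMeasure (Cluster.liftedMeasure μc η) ∧
    MeasureTheory.IsProbabilityMeasure (Cluster.clusterMeasure μc μ₀) ∧
    Measurable (Cluster.unpack (X := X)) ∧ Measurable (Cluster.qMap (X := X)) ∧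
    Cluster.clusterMeasure μc μ₀ = (Cluster.liftedMeasure μc η).map Cluster.qMap :=
  mainTheorem4_general μc μ₀ η hη
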